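/- **Theorem 2.4.** Let $A$ be a complex Banach algebra (not necessarily unital). A Banach $A$-bimodule is a complex Banach space $X$ with an $A$-bimodule structure whose left and right actions are bounded bilinear maps; its dual $X^*$ is a Banach $A$-bimodule via $\langle u, a\cdot\Lambda\rangle=\langle u\cdot a,\Lambda\rangle$ and $\langle u,\Lambda\cdot a\rangle=\langle a\cdot u,\Lambda\rangle$. A bounded linear map $D:A\to X$ is a derivation if $D(ab)=a\cdot D(b)+D(a)\cdot b$ for all $a,b\in A$, and it is approximately inner if there is a net $(x_\alpha)$ in $X$ (not required to be bounded) with $D(a)=\lim_\alpha (a\cdot x_\alpha-x_\alpha\cdot a)$ in norm for every $a\in A$. The algebra $A$ is approximately amenable if, for every Banach $A$-bimodule $X$, every bounded derivation $A\to X^*$ is approximately inner; it is approximately weakly amenable if every bounded derivation $A\to A^*$ is approximately inner, where $A^*$ is the dual of $A$ regarded as a bimodule over itself by multiplication. Let $\square$ be the first Arens product on the second dual $A^{**}$: for $a,b\in A$, $f\in A^*$ and $m,n\in A^{**}$, $$\langle f\,\square\, a,b\rangle=\langle f,ab\rangle,\qquad \langle m\,\square\, f,a\rangle=\langle m,f\,\square\,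 a\rangle,\qquad \langle m\,\square\, n,f\rangle=\langle m,n\,\square\, f\rangle .$$ With this product $(A^{**},\square)$ is a Banach algebra. (i) If $(A^{**},\square)$ is approximately amenable, then $A$ is approximately amenable. (ii) If every bounded linear operator $A\to A^*$ is weakly compact (that is, $B(A,A^*)=W(A,A^*)$) and $(A^{**},\square)$ is approximately weakly amenable, then $A$ is approximately weakly amenable. -/

import Mathlib

open Filter Topology

universe u v

/-- A Banach `A`-bimodule structure on the (complete) normed space `X`: bounded bilinear left and
right actions `a • x = left a x` and `x • a = right a x` satisfying the bimodule axioms.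
The algebra `A` need not be unital. -/
structure BanachBimodule (A : Type u) [NonUnitalNormedRing A] [NormedSpace ℂ A]
    (X : Type v) [NormedAddCommGroup X] [NormedSpace ℂ X] where
  left : A →L[ℂ] X →L[ℂ] X
  right : A →L[ℂ] X →L[ℂ] X
  left_mul : ∀ (a b : A) (x : X), left (a * b) x = left a (left b x)
  right_mul : ∀ (a b : A) (x : X), right (a * b) x = right b (right a x)
  left_right : ∀ (a b : A) (x : X), right b (left a x) = left a (right b x)

namespace BanachBimodule

section General

variable {A : Type u} [NonUnitalNormedRing A] [NormedSpace ℂ A]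
variable {X : Type v} [NormedAddCommGroup X] [NormedSpace ℂ X]

/-- The dual bimodule `X*`: `⟨u, a • Λ⟩ = ⟨u • a, Λ⟩` and `⟨u, Λ • a⟩ = ⟨a • u, Λ⟩`. -/
noncomputable def dual (M : BanachBimodule A X) : BanachBimodule A (StrongDual ℂ X) where
  left := ((ContinuousLinearMap.compL ℂ X X ℂ).flip).comp M.right
  right := ((ContinuousLinearMap.compL ℂ X X ℂ).flip).comp M.left
  left_mul a b Λ := by ext u; simp [M.right_mul]
  right_mul a b Λ := by ext u; simp [M.left_mul]
  left_right a b Λ := by ext u; simp [M.left_right]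

theorem dual_left_apply (M : BanachBimodule A X) (a : A) (Λ : StrongDual ℂ X) (u : X) :
    M.dual.left a Λ u = Λ (M.right a u) := rfl

theorem dual_right_apply (M : BanachBimodule A X) (a : A) (Λ : StrongDual ℂ X) (u : X) :
    M.dual.right a Λ u = Λ (M.left a u) := rfl

/-- A bounded linear map `D : A → X` is a derivation if `D (ab) = a • D b + D a • b`. -/
def IsDerivation (M : BanachBimodule A X) (D : A →L[ℂ] X) : Prop :=
  ∀ a b : A, D (a * b) = M.left a (D b) + M.right b (D a)

/-- `D : A → X` is approximately inner if there is a net `(x i)` in `X` (indexed by a nonempty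
directed preordered set) such that `D a = lim (a • x i - x i • a)` in norm, for every `a`. -/
def IsApproximatelyInner (M : BanachBimodule A X) (D : A →L[ℂ] X) : Prop :=
  ∃ (ι : Type (max u v)) (_ : Preorder ι) (_ : IsDirectedOrder ι) (_ : Nonempty ι) (x : ι → X),
    ∀ a : A, Tendsto (fun i => M.left a (x i) - M.right a (x i)) atTop (𝓝 (D a))

end General

section Regular

variable (A : Type u) [NonUnitalNormedRing A] [NormedSpace ℂ A] [IsScalarTower ℂ A A]
  [SMulCommClass ℂ A A]

/-- The algebra `A` as a bimodule over itself, the actions being multiplication. -/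
noncomputable def regular : BanachBimodule A A where
  left := ContinuousLinearMap.mul ℂ A
  right := (ContinuousLinearMap.mul ℂ A).flip
  left_mul a b x := by simp [mul_assoc]
  right_mul a b x := by simp [mul_assoc]
  left_right a b x := by simp [mul_assoc]

end Regular

end BanachBimodule

/-- `A` is approximately amenable: for each Banach `A`-bimodule `X`, every bounded derivation
`A → X*` is approximately inner. -/
def ApproximatelyAmenable (A : Type u) [NonUnitalNormedRing A] [NormedSpace ℂ A] : Prop :=
  ∀ (X : Type v) [NormedAddCommGroup X] [NormedSpace ℂ X] [CompleteSpace X]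
    (M : BanachBimodule A X) (D : A →L[ℂ] StrongDual ℂ X),
    M.dual.IsDerivation D → M.dual.IsApproximatelyInner D

/-- `A` is approximately weakly amenable: every bounded derivation `A → A*` is approximately
inner. -/
def ApproximatelyWeaklyAmenable (A : Type u) [NonUnitalNormedRing A] [NormedSpace ℂ A]
    [IsScalarTower ℂ A A] [SMulCommClass ℂ A A] : Prop :=
  ∀ D : A →L[ℂ] StrongDual ℂ A,
    (BanachBimodule.regular A).dual.IsDerivation D →
      (BanachBimodule.regular A).dual.IsApproximatelyInner D

/-- A bounded operator is weakly compact if the image of the closed unit ball is relatively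
compact in the weak topology of the target. -/
def IsWeaklyCompactOperator {E : Type u} {F : Type v} [NormedAddCommGroup E] [NormedSpace ℂ E]
    [NormedAddCommGroup F] [NormedSpace ℂ F] (T : E →L[ℂ] F) : Prop :=
  IsCompact (closure (toWeakSpace ℂ F '' (T '' Metric.closedBall (0 : E) 1)))

/-- The second dual `A**`, as a type of its own, to carry the first Arens product. -/
def SecondDual (A : Type u) [NonUnitalNormedRing A] [NormedSpace ℂ A] : Type u :=
  StrongDual ℂ (StrongDual ℂ A)

namespace SecondDual

section Normed

variable (A : Type u) [NonUnitalNormedRing A] [NormedSpace ℂ A]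

/-- `A**` as a normed group, before it is made into an algebra. -/
noncomputable abbrev normedAddCommGroup : NormedAddCommGroup (SecondDual A) :=
  inferInstanceAs (NormedAddCommGroup (StrongDual ℂ (StrongDual ℂ A)))

end Normed

section Arens

variable {A : Type u} [NonUnitalNormedRing A] [NormedSpace ℂ A] [IsScalarTower ℂ A A]
  [SMulCommClass ℂ A A]

/-- `f □ a ∈ A*` for `f ∈ A*` and `a ∈ A`: `⟨f □ a, b⟩ = ⟨f, ab⟩`. -/
noncomputable def dualMul : StrongDual ℂ A →L[ℂ] A →L[ℂ] StrongDual ℂ A :=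
  ((ContinuousLinearMap.compL ℂ A (A →L[ℂ] A) (StrongDual ℂ A)).flip
    (ContinuousLinearMap.mul ℂ A)).comp (ContinuousLinearMap.compL ℂ A A ℂ)

theorem dualMul_apply (f : StrongDual ℂ A) (a b : A) : dualMul f a b = f (a * b) := rfl

/-- `m □ f ∈ A*` for `m ∈ A**` and `f ∈ A*`: `⟨m □ f, a⟩ = ⟨m, f □ a⟩`. -/
noncomputable def act (m : StrongDual ℂ (StrongDual ℂ A)) : StrongDual ℂ A →L[ℂ] StrongDual ℂ A :=
  (ContinuousLinearMap.compL ℂ A (StrongDual ℂ A) ℂ m).comp dualMul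

theorem act_apply (m : StrongDual ℂ (StrongDual ℂ A)) (f : StrongDual ℂ A) (a : A) :
    act m f a = m (dualMul f a) := rfl

/-- The first Arens product: `⟨m □ n, f⟩ = ⟨m, n □ f⟩`. -/
noncomputable def arens (m n : StrongDual ℂ (StrongDual ℂ A)) : StrongDual ℂ (StrongDual ℂ A) :=
  m.comp (act n)

theorem arens_apply (m n : StrongDual ℂ (StrongDual ℂ A)) (f : StrongDual ℂ A) :
    arens m n f = m (act n f) := rfl

theorem dualMul_mul (f : StrongDual ℂ A) (a b : A) :
    dualMul f (a * b) = dualMul (dualMul f a) b := by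
  ext c; simp [dualMul_apply, mul_assoc]

theorem act_dualMul (m : StrongDual ℂ (StrongDual ℂ A)) (f : StrongDual ℂ A) (a : A) :
    act m (dualMul f a) = dualMul (act m f) a := by
  ext b; simp [act_apply, dualMul_apply, dualMul_mul]

theorem arens_assoc (m n p : StrongDual ℂ (StrongDual ℂ A)) :
    arens (arens m n) p = arens m (arens n p) := by
  have h (f : StrongDual ℂ A) : act n (act p f) = act (arens n p) f := by
    ext a; simp [act_apply, arens_apply, act_dualMul]
  ext f; simp [arens_apply, h]

theorem norm_dualMul_le (f : StrongDual ℂ A) : ‖dualMul f‖ ≤ ‖f‖ := by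
  refine ContinuousLinearMap.opNorm_le_bound _ (norm_nonneg _) fun a => ?_
  refine ContinuousLinearMap.opNorm_le_bound _ (by positivity) fun b => ?_
  calc ‖f (a * b)‖ ≤ ‖f‖ * ‖a * b‖ := f.le_opNorm _
    _ ≤ ‖f‖ * (‖a‖ * ‖b‖) := by gcongr; exact norm_mul_le a b
    _ = ‖f‖ * ‖a‖ * ‖b‖ := by ring

theorem norm_act_le (m : StrongDual ℂ (StrongDual ℂ A)) : ‖act m‖ ≤ ‖m‖ := by
  refine ContinuousLinearMap.opNorm_le_bound _ (norm_nonneg m) fun f => ?_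
  calc ‖m.comp (dualMul f)‖ ≤ ‖m‖ * ‖dualMul f‖ := ContinuousLinearMap.opNorm_comp_le _ _
    _ ≤ ‖m‖ * ‖f‖ := by gcongr; exact norm_dualMul_le f

theorem norm_arens_le (m n : StrongDual ℂ (StrongDual ℂ A)) : ‖arens m n‖ ≤ ‖m‖ * ‖n‖ :=
  (ContinuousLinearMap.opNorm_comp_le _ _).trans (by gcongr; exact norm_act_le n)

theorem arens_add (m n p : StrongDual ℂ (StrongDual ℂ A)) :
    arens m (n + p) = arens m n + arens m p := by
  simp [arens, act]

theorem add_arens (m n p : StrongDual ℂ (StrongDual ℂ A)) :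
    arens (m + n) p = arens m p + arens n p := by
  simp [arens]

theorem smul_arens (c : ℂ) (m n : StrongDual ℂ (StrongDual ℂ A)) :
    arens (c • m) n = c • arens m n := by
  simp [arens]

theorem arens_smul (c : ℂ) (m n : StrongDual ℂ (StrongDual ℂ A)) :
    arens m (c • n) = c • arens m n := by
  simp [arens, act]

/-- `A**` with the first Arens product as multiplication. -/
noncomputable instance instNonUnitalNormedRing : NonUnitalNormedRing (SecondDual A) where
  __ := normedAddCommGroup A
  mul := arens
  left_distrib := arens_add
  right_distrib := add_arens
  zero_mul m := by
    have h := add_arens (A := A) 0 0 m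
    rw [add_zero] at h
    exact left_eq_add.mp h
  mul_zero m := by
    have h := arens_add (A := A) m 0 0
    rw [add_zero] at h
    exact left_eq_add.mp h
  mul_assoc := arens_assoc
  norm_mul_le := norm_arens_le

noncomputable instance instNormedSpace : NormedSpace ℂ (SecondDual A) :=
  inferInstanceAs (NormedSpace ℂ (StrongDual ℂ (StrongDual ℂ A)))

instance instIsScalarTower : IsScalarTower ℂ (SecondDual A) (SecondDual A) :=
  ⟨fun c m n => smul_arens c m n⟩

instance instSMulCommClass : SMulCommClass ℂ (SecondDual A) (SecondDual A) :=
  ⟨fun c m n => (arens_smul c m n).symm⟩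

instance instCompleteSpace : CompleteSpace (SecondDual A) :=
  inferInstanceAs (CompleteSpace (StrongDual ℂ (StrongDual ℂ A)))

end Arens

end SecondDual

/-! A derivation `D : A → Y` extends to `D** : A** → Y**`, a derivation when both actions on `Y` are
extended by iterated limits in the order defining `□`. For (i), take `Y = X*`. Approximate
amenability of `A**` controls derivations into all Banach bimodules, not only dual ones: pass to the
second dual of the module and return by `IsApproximatelyInner.of_dual_dual`, a Mazur-type
Hahn–Banach argument. Hence `D**` is approximately inner; restrict it to `A` and descend once more
from `Y**` to `Y`. For (ii), take `Y = A*`. The extended actions on `A***` must be those dual to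
multiplication in `A**`. The right one always is; the left one needs two iterated limits exchanged,
which weak compactness allows: by Gantmacher's theorem the bilinear forms involved are Arens regular
(`IsWeaklyCompactOperator.bidual_comm`). Restricting functionals from `A**` to `A` then carries the
net in `A***` to one in `A*`. -/

namespace ContinuousLinearMap

variable {E F G : Type*} [NormedAddCommGroup E] [NormedSpace ℂ E]
  [NormedAddCommGroup F] [NormedSpace ℂ F] [NormedAddCommGroup G] [NormedSpace ℂ G]

/-- The adjoint `T* : F* → E*` of a bounded operator `T : E → F`. -/
noncomputable def dualAdjoint (T : E →L[ℂ] F) : StrongDual ℂ F →L[ℂ] StrongDual ℂ E :=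
  (compL ℂ E F ℂ).flip T

/-- The second adjoint `T** : E** → F**` of a bounded operator `T : E → F`. -/
noncomputable def secondAdjoint (T : E →L[ℂ] F) :
    StrongDual ℂ (StrongDual ℂ E) →L[ℂ] StrongDual ℂ (StrongDual ℂ F) :=
  T.dualAdjoint.dualAdjoint

theorem secondAdjoint_apply (T : E →L[ℂ] F) (m : StrongDual ℂ (StrongDual ℂ E))
    (g : StrongDual ℂ F) : T.secondAdjoint m g = m (g.comp T) := rfl

/-- The Arens adjoint `G* × E → F*` of a bounded bilinear map `B : E × F → G`:
`⟨y, B*(g, x)⟩ = ⟨B(x, y), g⟩`. -/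
noncomputable def arensAdjoint (B : E →L[ℂ] F →L[ℂ] G) :
    StrongDual ℂ G →L[ℂ] E →L[ℂ] StrongDual ℂ F :=
  ((compL ℂ E (F →L[ℂ] G) (StrongDual ℂ F)).flip B).comp (compL ℂ F G ℂ)

theorem arensAdjoint_apply (B : E →L[ℂ] F →L[ℂ] G) (g : StrongDual ℂ G) (x : E) (y : F) :
    B.arensAdjoint g x y = g (B x y) := rfl

end ContinuousLinearMap

/-! ### Arens extensions of modules and derivations to the second dual. -/

namespace SecondDual

variable {A : Type u} [NonUnitalNormedRing A] [NormedSpace ℂ A] [IsScalarTower ℂ A A]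
  [SMulCommClass ℂ A A]

/-- The identity map from the Banach algebra `A**` to the iterated dual of `A`. -/
noncomputable def toBidual : SecondDual A →L[ℂ] StrongDual ℂ (StrongDual ℂ A) :=
  ContinuousLinearMap.id ℂ (StrongDual ℂ (StrongDual ℂ A))

/-- The canonical embedding of `A` in the Banach algebra `A**`. -/
noncomputable def incl : A →L[ℂ] SecondDual A :=
  NormedSpace.inclusionInDoubleDual ℂ A

theorem toBidual_mul (m n : SecondDual A) (f : StrongDual ℂ A) :
    toBidual (m * n) f = toBidual m (act (toBidual n) f) := rfl

theorem incl_mul (a b : A) : incl (a * b) = incl a * incl b := by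
  apply ContinuousLinearMap.ext
  intro f
  rfl

end SecondDual

namespace BanachBimodule

open ContinuousLinearMap SecondDual

variable {A : Type u} [NonUnitalNormedRing A] [NormedSpace ℂ A]
variable {X : Type v} [NormedAddCommGroup X] [NormedSpace ℂ X]

variable [IsScalarTower ℂ A A] [SMulCommClass ℂ A A]

/-- The second dual `X**` of a Banach `A`-bimodule `X`, as a Banach bimodule over `(A**, □)`. -/
noncomputable def bidual (M : BanachBimodule A X) :
    BanachBimodule (SecondDual A) (StrongDual ℂ (StrongDual ℂ X)) where
  left := M.left.arensAdjoint.arensAdjoint.arensAdjoint.comp toBidual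
  -- The flips put the module variable outermost, so factors are read from left to right as in `□`.
  right := M.right.flip.arensAdjoint.arensAdjoint.arensAdjoint.flip.comp toBidual
  left_mul m n Φ := by
    ext g
    simp only [comp_apply, arensAdjoint_apply, toBidual_mul]
    congr 1
    ext a
    simp only [act_apply, arensAdjoint_apply]
    congr 1
    ext b
    simp only [dualMul_apply, arensAdjoint_apply]
    congr 1
    ext x
    simp only [arensAdjoint_apply, M.left_mul]
  right_mul m n Φ := by
    ext g
    simp only [comp_apply, flip_apply, arensAdjoint_apply]
    congr 1
    ext x
    simp only [arensAdjoint_apply, toBidual_mul]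
    congr 1
    ext a
    simp only [act_apply, arensAdjoint_apply]
    congr 1
    ext b
    simp only [dualMul_apply, arensAdjoint_apply, flip_apply, M.right_mul]
  left_right m n Φ := by
    ext g
    simp only [comp_apply, flip_apply, arensAdjoint_apply]
    congr 1
    ext a
    simp only [arensAdjoint_apply]
    congr 1
    ext x
    simp only [arensAdjoint_apply]
    congr 1
    ext b
    simp only [arensAdjoint_apply, flip_apply, M.left_right]

theorem bidual_left_apply (M : BanachBimodule A X) (m : SecondDual A)
    (Φ : StrongDual ℂ (StrongDual ℂ X)) (g : StrongDual ℂ X) :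
    M.bidual.left m Φ g = toBidual m (M.left.arensAdjoint.arensAdjoint Φ g) := rfl

theorem bidual_right_apply (M : BanachBimodule A X) (m : SecondDual A)
    (Φ : StrongDual ℂ (StrongDual ℂ X)) (g : StrongDual ℂ X) :
    M.bidual.right m Φ g =
      Φ (M.right.flip.arensAdjoint.arensAdjoint (toBidual m) g) := rfl

/-- The second adjoint of a derivation is a derivation on `(A**, □)`. -/
theorem IsDerivation.secondAdjoint {M : BanachBimodule A X} {D : A →L[ℂ] X}
    (hD : M.IsDerivation D) : M.bidual.IsDerivation (D.secondAdjoint.comp toBidual) := by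
  intro m n
  ext g
  -- All three terms have the form `m (a ↦ n (b ↦ _))` with `m` outside, so no limits are exchanged.
  simp only [comp_apply, secondAdjoint_apply, toBidual_mul, add_apply, bidual_left_apply,
    bidual_right_apply, ← map_add]
  congr 1
  ext a
  simp only [act_apply, add_apply, comp_apply, arensAdjoint_apply, secondAdjoint_apply, ← map_add]
  congr 1
  ext b
  simp [dualMul_apply, hD a b, arensAdjoint_apply]

end BanachBimodule

/-! ### Descent from the second dual module. -/

namespace BanachBimodule

variable {A : Type u} [NonUnitalNormedRing A] [NormedSpace ℂ A]
variable {X : Type v} [NormedAddCommGroup X] [NormedSpace ℂ X]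

/-- A derivation that can be approximated by inner derivations on each finite set is
approximately inner. -/
theorem isApproximatelyInner_of_finset {M : BanachBimodule A X} {D : A →L[ℂ] X}
    (h : ∀ (S : Finset A) (ε : ℝ), 0 < ε →
      ∃ x, ∀ a ∈ S, ‖M.left a x - M.right a x - D a‖ < ε) :
    M.IsApproximatelyInner D := by
  classical
  choose x hx using fun p : Finset A × ℕ => h p.1 (1 / ((p.2 : ℝ) + 1)) (by positivity)
  refine ⟨ULift.{max u v} (Finset A × ℕ), inferInstance, ⟨fun i j => ⟨⟨i.down ⊔ j.down⟩,
    ⟨(le_sup_left : i.down ≤ i.down ⊔ j.down), (le_sup_right : j.down ≤ i.down ⊔ j.down)⟩⟩⟩,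
    inferInstance, fun i => x i.down, fun a => ?_⟩
  rw [Metric.tendsto_nhds]
  intro ε hε
  obtain ⟨n, hn⟩ := exists_nat_one_div_lt hε
  filter_upwards [eventually_ge_atTop ⟨({a}, n)⟩] with i hi
  have hi' : (({a}, n) : Finset A × ℕ) ≤ i.down := hi
  rw [dist_eq_norm]
  refine (hx i.down a (hi'.1 (by simp))).trans_le (le_trans ?_ hn.le)
  have : (n : ℝ) ≤ i.down.2 := by exact_mod_cast hi'.2
  gcongr

/-- If a bounded operator is approximately inner as a map into the second dual bimodule, then it
is approximately inner. -/
theorem IsApproximatelyInner.of_dual_dual {M : BanachBimodule A X} {D : A →L[ℂ] X}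
    (h : M.dual.dual.IsApproximatelyInner ((NormedSpace.inclusionInDoubleDual ℂ X).comp D)) :
    M.IsApproximatelyInner D := by
  classical
  refine isApproximatelyInner_of_finset fun S ε hε => ?_
  -- `T x` lists the values on `S` of the inner derivation given by `x`.
  let T : X →L[ℂ] (S → X) := ContinuousLinearMap.pi fun a => M.left a - M.right a
  suffices hcl : (fun a : S => D a) ∈ closure (Set.range T) by
    obtain ⟨_, ⟨x, rfl⟩, hx⟩ := Metric.mem_closure_iff.1 hcl ε hε
    refine ⟨x, fun a ha => ?_⟩
    rw [dist_comm, dist_eq_norm] at hx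
    exact (norm_le_pi_norm _ (⟨a, ha⟩ : S)).trans_lt hx
  by_contra hcl
  have hconv : Convex ℝ (closure (Set.range T)) :=
    ((LinearMap.range T.toLinearMap).restrictScalars ℝ).convex.closure
  obtain ⟨φ, c, hφ, hc⟩ := RCLike.geometric_hahn_banach_closed_point (𝕜 := ℂ) hconv
    isClosed_closure hcl
  -- A functional whose real part is bounded above on a subspace vanishes there: rescaling `x` would
  -- give the value `c + 1`.
  have hzero (x : X) : φ (T x) = 0 := by
    by_contra hne
    have := hφ (T (((c + 1 : ℝ) / φ (T x)) • x)) (subset_closure ⟨_, rfl⟩)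
    rw [map_smul, map_smul, smul_eq_mul, div_mul_cancel₀ _ hne] at this
    norm_num at this
  have hc0 : 0 < c := by simpa using hφ 0 (subset_closure ⟨0, map_zero T⟩)
  let g (a : S) : StrongDual ℂ X := φ.comp (ContinuousLinearMap.single ℂ (fun _ : S => X) a)
  have hsum (y : S → X) : φ y = ∑ a, g a (y a) := by
    conv_lhs => rw [← Finset.univ_sum_single y]
    simp [g]
  have hg : ∑ a : S, (M.dual.right a (g a) - M.dual.left a (g a)) = 0 := by
    ext x
    have := hzero x
    rw [hsum] at this
    simpa [T, dual_right_apply, dual_left_apply] using this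
  obtain ⟨ι, _, _, _, Φ, hΦ⟩ := h
  have hlim : Tendsto (fun i => ∑ a : S,
      (M.dual.dual.left a (Φ i) - M.dual.dual.right a (Φ i)) (g a)) atTop
      (𝓝 (∑ a : S, g a (D a))) :=
    tendsto_finsetSum _ fun a _ =>
      ((ContinuousLinearMap.apply ℂ ℂ (g a)).continuous.tendsto _).comp (hΦ a)
  -- Pairing `Φ i` with the relation `hg` kills every inner derivation, so the limit `φ (D a)_a` is
  -- zero, against `0 < c`.
  have hval (i : ι) : ∑ a : S,
      (M.dual.dual.left a (Φ i) - M.dual.dual.right a (Φ i)) (g a) = 0 := by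
    have := congrArg (Φ i) hg
    simpa [dual_left_apply, dual_right_apply] using this
  simp only [hval] at hlim
  rw [hsum, ← tendsto_nhds_unique tendsto_const_nhds hlim] at hc
  simp at hc
  linarith

/-- Over an approximately amenable algebra, derivations into arbitrary (not necessarily dual)
Banach bimodules are approximately inner. -/
theorem IsDerivation.isApproximatelyInner {M : BanachBimodule A X} {D : A →L[ℂ] X}
    (hA : ApproximatelyAmenable.{u, v} A) (hD : M.IsDerivation D) : M.IsApproximatelyInner D := by
  refine IsApproximatelyInner.of_dual_dual (hA _ M.dual _ fun a b => ?_)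
  ext g
  simp [hD a b, dual_left_apply, dual_right_apply]

end BanachBimodule

open BanachBimodule SecondDual in
/-- Approximate amenability passes from `(A**, □)` to `A`. -/
theorem ApproximatelyAmenable.of_secondDual {A : Type u} [NonUnitalNormedRing A] [NormedSpace ℂ A]
    [IsScalarTower ℂ A A] [SMulCommClass ℂ A A]
    (hA : ApproximatelyAmenable.{u, v} (SecondDual A)) : ApproximatelyAmenable.{u, v} A := by
  intro X _ _ _ M D hD
  obtain ⟨ι, _, _, _, Φ, hΦ⟩ := hD.secondAdjoint.isApproximatelyInner hA
  -- Along `incl`, the Arens-extended actions are definitionally the double dual actions of `A`, and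
  -- `D**` is `D` followed by the canonical embedding.
  exact IsApproximatelyInner.of_dual_dual ⟨ι, _, ‹_›, ‹_›, Φ, fun a => hΦ (incl a)⟩

/-! ### Weak compactness and Arens regularity. -/

/-- The finite-dimensional case of Goldstine's theorem: on finitely many functionals `g ∘ T`, an
element of the closed unit ball of `E**` is a limit of elements of the closed unit ball of `E`. -/
theorem mem_closure_image_closedBall {E F : Type*} [NormedAddCommGroup E] [NormedSpace ℂ E]
    [NormedAddCommGroup F] [NormedSpace ℂ F] (T : E →L[ℂ] F) (m : StrongDual ℂ (StrongDual ℂ E))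
    (hm : ‖m‖ ≤ 1) (S : Finset (StrongDual ℂ F)) :
    (fun g : S => m (g.1.comp T)) ∈
      closure ((fun y (g : S) => g.1 y) '' (T '' Metric.closedBall (0 : E) 1)) := by
  classical
  let P : E →L[ℂ] (S → ℂ) := ContinuousLinearMap.pi fun g => g.1.comp T
  have himg : (fun y (g : S) => g.1 y) '' (T '' Metric.closedBall (0 : E) 1) =
      P '' Metric.closedBall (0 : E) 1 := by
    rw [Set.image_image]; rfl
  rw [himg]
  by_contra hcl
  have hconv : Convex ℝ (closure (P '' Metric.closedBall (0 : E) 1)) :=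
    ((convex_closedBall (0 : E) 1).linear_image (P.toLinearMap.restrictScalars ℝ)).closure
  obtain ⟨φ, c, hφ, hc⟩ := RCLike.geometric_hahn_banach_closed_point (𝕜 := ℂ) hconv
    isClosed_closure hcl
  have hsum (z : S → ℂ) : φ z = ∑ g, z g * φ (Pi.single g 1) := by
    conv_lhs => rw [← Finset.univ_sum_single z]
    rw [map_sum]
    refine Finset.sum_congr rfl fun g _ => ?_
    rw [← smul_eq_mul, ← map_smul, ← Pi.single_smul, smul_eq_mul, mul_one]
  have hval : φ (fun g : S => m (g.1.comp T)) = m (φ.comp P) := by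
    have : φ.comp P = ∑ g : S, φ (Pi.single g 1) • g.1.comp T := by
      ext x
      rw [ContinuousLinearMap.comp_apply, hsum (P x)]
      simp [P, mul_comm]
    rw [this, hsum]
    simp [mul_comm]
  have hc0 : 0 < c := by
    simpa using hφ 0 (subset_closure ⟨0, by simp, map_zero P⟩)
  have hnorm : ‖φ.comp P‖ ≤ c := by
    refine ContinuousLinearMap.opNorm_le_of_unit_norm hc0.le fun x hx => ?_
    rcases eq_or_ne (φ (P x)) 0 with h0 | h0
    · simp [h0, hc0.le]
    have hn : (‖φ (P x)‖ : ℂ) ≠ 0 := by simpa using h0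
    -- Rotating `x` by a phase makes `φ (P x)` real and nonnegative, so the bound on real parts
    -- bounds the modulus.
    have hmem : ((‖φ (P x)‖ : ℂ) / φ (P x)) • x ∈ Metric.closedBall (0 : E) 1 := by
      simp [norm_smul, hx, h0]
    have := hφ _ (subset_closure ⟨_, hmem, rfl⟩)
    rw [map_smul, map_smul, smul_eq_mul, div_mul_cancel₀ _ h0] at this
    simpa using this.le
  rw [hval] at hc
  have h1 : ‖m (φ.comp P)‖ ≤ c :=
    (m.le_of_opNorm_le hm _).trans (by simpa using hnorm)
  exact absurd hc (not_lt.2 ((RCLike.re_le_norm _).trans h1))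

/-- Gantmacher's theorem: the second adjoint of a weakly compact operator `T : E → F` maps `E**`
into the canonical image of `F`. -/
theorem IsWeaklyCompactOperator.exists_eq_secondAdjoint {E : Type u} {F : Type v}
    [NormedAddCommGroup E] [NormedSpace ℂ E] [NormedAddCommGroup F] [NormedSpace ℂ F]
    {T : E →L[ℂ] F} (hT : IsWeaklyCompactOperator T) (m : StrongDual ℂ (StrongDual ℂ E)) :
    ∃ y : F, ∀ g : StrongDual ℂ F, g y = m (g.comp T) := by
  wlog hm : ‖m‖ ≤ 1 generalizing m
  · have hm0 : (‖m‖ : ℂ) ≠ 0 := by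
      norm_cast
      intro h
      simp [h] at hm
    obtain ⟨y, hy⟩ := this ((‖m‖ : ℂ)⁻¹ • m)
      ((ContinuousLinearMap.opNorm_smul_le _ m).trans_eq (by
      rw [norm_inv, Complex.norm_real, Real.norm_of_nonneg m.opNorm_nonneg]
      exact inv_mul_cancel₀ (by exact_mod_cast hm0)))
    refine ⟨(‖m‖ : ℂ) • y, fun g => ?_⟩
    simp [hy, hm0]
  have hcont (g : StrongDual ℂ F) :
      Continuous fun y : WeakSpace ℂ F => g ((toWeakSpace ℂ F).symm y) :=
    WeakBilin.eval_continuous (topDualPairing ℂ F).flip g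
  -- By compactness, finitely many conditions `g y = m (g ∘ T)` suffice. They are solvable because
  -- the image of the weakly compact set in `S → ℂ` is compact, hence closed, and so contains the
  -- Goldstine point.
  obtain ⟨y, -, hy⟩ := hT.inter_iInter_nonempty
    (fun g : StrongDual ℂ F => {y | g ((toWeakSpace ℂ F).symm y) = m (g.comp T)})
    (fun g => isClosed_eq (hcont g) continuous_const) fun S => by
      have hQ : Continuous fun (y : WeakSpace ℂ F) (g : S) => g.1 ((toWeakSpace ℂ F).symm y) :=
        continuous_pi fun g => hcont g.1
      have hmem := mem_closure_image_closedBall T m hm S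
      have hsub : (fun y (g : S) => g.1 y) '' (T '' Metric.closedBall (0 : E) 1) ⊆
          (fun (y : WeakSpace ℂ F) (g : S) => g.1 ((toWeakSpace ℂ F).symm y)) ''
            closure (toWeakSpace ℂ F '' (T '' Metric.closedBall (0 : E) 1)) := by
        rintro _ ⟨y, hy, rfl⟩
        exact ⟨toWeakSpace ℂ F y, subset_closure ⟨y, hy, rfl⟩, rfl⟩
      obtain ⟨y, hyK, hy⟩ := closure_minimal hsub (hT.image hQ).isClosed hmem
      refine ⟨y, hyK, Set.mem_iInter₂.2 fun g hg => ?_⟩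
      exact congrFun hy ⟨g, hg⟩
  exact ⟨(toWeakSpace ℂ F).symm y, fun g => Set.mem_iInter.1 hy g⟩

open ContinuousLinearMap in
/-- A weakly compact operator `T : E → F*` is Arens regular as a bilinear form: its two extensions
to `F** × E**` agree. -/
theorem IsWeaklyCompactOperator.bidual_comm {E : Type u} {F : Type v}
    [NormedAddCommGroup E] [NormedSpace ℂ E] [NormedAddCommGroup F] [NormedSpace ℂ F]
    {T : E →L[ℂ] StrongDual ℂ F} (hT : IsWeaklyCompactOperator T)
    (m : StrongDual ℂ (StrongDual ℂ F)) (n : StrongDual ℂ (StrongDual ℂ E)) :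
    m (n.comp T.flip) = n (m.comp T) := by
  obtain ⟨f, hf⟩ := hT.exists_eq_secondAdjoint n
  rw [← hf]
  congr 1
  ext y
  -- Evaluations at points of `F` identify `f` with `n.comp T.flip`.
  exact (hf (NormedSpace.inclusionInDoubleDual ℂ F y)).symm

/-! ### Derivations into the dual of the algebra. -/

namespace BanachBimodule

open ContinuousLinearMap SecondDual

variable {A : Type u} [NonUnitalNormedRing A] [NormedSpace ℂ A] [IsScalarTower ℂ A A]
  [SMulCommClass ℂ A A]

/-- The second adjoint of `D : A → A*`, as a map from the Banach algebra `A**` to its dual. -/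
noncomputable def bidualExtension (D : A →L[ℂ] StrongDual ℂ A) :
    SecondDual A →L[ℂ] StrongDual ℂ (SecondDual A) :=
  (dualAdjoint (toBidual (A := A))).comp (D.secondAdjoint.comp toBidual)

/-- If all operators `A → A*` are weakly compact, then `⟨p, m □ f⟩ = ⟨m, a ↦ ⟨p, a • f⟩⟩`. -/
theorem apply_act_eq (hA : ∀ T : A →L[ℂ] StrongDual ℂ A, IsWeaklyCompactOperator T)
    (m p : StrongDual ℂ (StrongDual ℂ A)) (f : StrongDual ℂ A) :
    p (act m f) = m (p.comp ((regular A).dual.left.flip f)) :=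
  (hA ((regular A).dual.left.flip f)).bidual_comm p m

/-- If all operators `A → A*` are weakly compact, then the second adjoint of a derivation
`A → A*` is a derivation `A** → A***`. -/
theorem IsDerivation.bidualExtension
    (hA : ∀ T : A →L[ℂ] StrongDual ℂ A, IsWeaklyCompactOperator T)
    {D : A →L[ℂ] StrongDual ℂ A} (hD : (regular A).dual.IsDerivation D) :
    (regular (SecondDual A)).dual.IsDerivation (bidualExtension D) := by
  intro m n
  ext p
  have hleft : (regular A).dual.bidual.left m (D.secondAdjoint (toBidual n)) (toBidual p) =
      toBidual n ((toBidual (p * m)).comp D) := by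
    -- `R b a = p (a • D b)`. Regularity of `R` exchanges `m` and `n`; regularity of `a ↦ a • D b`
    -- then exchanges `m` and `p`.
    let R : A →L[ℂ] StrongDual ℂ A :=
      (compL ℂ A (StrongDual ℂ A) ℂ (toBidual p)).comp ((regular A).dual.left.flip.comp D)
    calc _ = toBidual m ((toBidual n).comp R.flip) := rfl
      _ = toBidual n ((toBidual m).comp R) := (hA R).bidual_comm _ _
      _ = _ := by
        congr 1
        ext b
        exact (apply_act_eq hA (toBidual m) (toBidual p) (D b)).symm
  have h := congrArg (fun Φ => Φ (toBidual p)) (hD.secondAdjoint m n)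
  -- The right actions agree definitionally.
  exact h.trans (congrArg₂ (· + ·) hleft rfl)

end BanachBimodule

open BanachBimodule SecondDual in
/-- Approximate weak amenability passes from `(A**, □)` to `A` if every bounded operator
`A → A*` is weakly compact. -/
theorem ApproximatelyWeaklyAmenable.of_secondDual {A : Type u} [NonUnitalNormedRing A]
    [NormedSpace ℂ A] [IsScalarTower ℂ A A] [SMulCommClass ℂ A A]
    (hW : ∀ T : A →L[ℂ] StrongDual ℂ A, IsWeaklyCompactOperator T)
    (hA : ApproximatelyWeaklyAmenable (SecondDual A)) : ApproximatelyWeaklyAmenable A := by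
  intro D hD
  obtain ⟨ι, _, _, _, Φ, hΦ⟩ := hA _ (hD.bidualExtension hW)
  -- Restriction to `A` respects the `A`-actions since `incl` is multiplicative, and it sends the
  -- extension of `D` at `incl a` back to `D a`.
  let r : StrongDual ℂ (SecondDual A) →L[ℂ] StrongDual ℂ A := (incl (A := A)).dualAdjoint
  refine ⟨ι, _, ‹_›, ‹_›, fun i => r (Φ i), fun a => ?_⟩
  convert (r.continuous.tendsto _).comp (hΦ (incl a)) using 1
  · funext i
    ext b
    change Φ i (incl (b * a)) - Φ i (incl (a * b)) =
      Φ i (incl b * incl a) - Φ i (incl a * incl b)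
    rw [incl_mul, incl_mul]
  · congr 1

theorem theorem2p4 (A : Type u) [NonUnitalNormedRing A] [NormedSpace ℂ A] [IsScalarTower ℂ A A]
    [SMulCommClass ℂ A A] [CompleteSpace A] :
    (ApproximatelyAmenable.{u, v} (SecondDual A) → ApproximatelyAmenable.{u, v} A) ∧
    ((∀ T : A →L[ℂ] StrongDual ℂ A, IsWeaklyCompactOperator T) →
      ApproximatelyWeaklyAmenable (SecondDual A) → ApproximatelyWeaklyAmenable A) :=
  ⟨.of_secondDual, .of_secondDual⟩
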